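/- Let $G$ be a finite simple graph that contains neither the claw nor the paw as an induced subgraph, where the claw is $K_{1,3}$ and the paw is the graph on four vertices obtained from a triangle by attaching one pendant edge. Then the chromatic symmetric function $$X_G=\sum_{\kappa}\ \prod_{v\in V(G)} x_{\kappa(v)},$$ where the sum is over all proper colorings $\kappa: V(G)\to\{1,2,3,\dots\}$ of $G$, is $e$-positive; that is, $X_G$ is a linear combination with nonnegative (rational) coefficients of the elementary symmetric functions $e_\lambda=e_{\lambda_1}e_{\lambda_2}\cdots e_{\lambda_\ell}$, $\lambda=(\lambda_1,\dots,\lambda_\ell)$ ranging over the integer partitions, with $e_i=\sum_{j_1<\dots<j_i}x_{j_1}\cdots x_{j_i}$. -/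

import Mathlib

noncomputable section

/-- The formal sum `∑ i, x ^ (m i)` of a family of monomials in the variables `x_0, x_1, x_2, …`
with rational coefficients: the coefficient of `x ^ d` is the number of indices `i` with `m i = d`.
It is meaningful when every monomial occurs finitely often, which is proved below for the
families that are used. -/
def monomialSum {ι : Type*} (m : ι → (ℕ →₀ ℕ)) : MvPowerSeries ℕ ℚ :=
  fun d => (Nat.card {i : ι // m i = d} : ℚ)

/-- The exponent of the monomial `∏ v, x_{κ v}` of a coloring `κ : V → ℕ`. -/
def colorExponent {V : Type*} [Fintype V] (κ : V → ℕ) : ℕ →₀ ℕ :=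
  ∑ v, Finsupp.single (κ v) 1

/-- The chromatic symmetric function `X_G = ∑ κ, ∏ v, x_{κ v}`, the sum being over all proper
colorings `κ` of `G` with colors in a countably infinite set (here `ℕ`, so the variables
`x_1, x_2, …` are numbered from `0`). -/
def chromaticSymmetricFunction {V : Type*} [Fintype V] (G : SimpleGraph V) : MvPowerSeries ℕ ℚ :=
  monomialSum fun κ : G.Coloring ℕ => colorExponent κ

/-- The elementary symmetric function `e_n = ∑_{j_1 < ⋯ < j_n} x_{j_1} ⋯ x_{j_n}`, the sum of the
squarefree monomials of the `n`-element sets of variables. -/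
def elemSymm (n : ℕ) : MvPowerSeries ℕ ℚ :=
  monomialSum fun s : {s : Finset ℕ // s.card = n} => ∑ j ∈ s.1, Finsupp.single j 1

/-- `e_λ = e_{λ_1} e_{λ_2} ⋯ e_{λ_ℓ}` for a partition `λ`. -/
def elemSymmPart {n : ℕ} (lam : n.Partition) : MvPowerSeries ℕ ℚ :=
  (lam.parts.map elemSymm).prod

/-- `f` is e-positive: it is a (finite) linear combination of the `e_λ`, `λ` ranging over all
partitions, with nonnegative coefficients. -/
def IsEPositive (f : MvPowerSeries ℕ ℚ) : Prop :=
  ∃ c : (Σ n : ℕ, n.Partition) →₀ ℚ, (∀ p, 0 ≤ c p) ∧ f = c.sum fun p a => a • elemSymmPart p.2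

/-- The claw `K_{1,3}`. -/
def clawGraph : SimpleGraph (Fin 1 ⊕ Fin 3) := completeBipartiteGraph (Fin 1) (Fin 3)

/-- The paw: the triangle `1, 2, 3` with the pendant edge `0, 1`. -/
def pawGraph : SimpleGraph (Fin 4) :=
  SimpleGraph.fromEdgeSet {s(0, 1), s(1, 2), s(1, 3), s(2, 3)}

theorem colorExponent_apply_pos {V : Type*} [Fintype V] (κ : V → ℕ) (v : V) :
    0 < colorExponent κ (κ v) := by
  classical
  rw [colorExponent, Finsupp.finsetSum_apply]
  exact Finset.sum_pos' (fun _ _ => Nat.zero_le _) ⟨v, Finset.mem_univ v, by simp⟩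

/-- Only finitely many colorings contribute to a given monomial. -/
theorem finite_colorExponent_fiber {V : Type*} [Fintype V] (G : SimpleGraph V) (d : ℕ →₀ ℕ) :
    Finite {κ : G.Coloring ℕ // colorExponent κ = d} := by
  classical
  refine Finite.of_injective
    (fun κ : {κ : G.Coloring ℕ // colorExponent κ = d} => fun v : V =>
      (⟨κ.1 v, by
        have h := colorExponent_apply_pos κ.1 v
        rw [κ.2] at h
        exact Finsupp.mem_support_iff.mpr h.ne'⟩ : d.support)) ?_
  intro κ κ' h
  apply Subtype.ext
  apply RelHom.ext
  intro v
  exact congrArg Subtype.val (congrFun h v)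

/-- A squarefree monomial determines its set of variables. -/
theorem finite_elemSymm_fiber (n : ℕ) (d : ℕ →₀ ℕ) :
    Finite {s : {s : Finset ℕ // s.card = n} // ∑ j ∈ s.1, Finsupp.single j 1 = d} := by
  classical
  have key : ∀ s : Finset ℕ, (∑ j ∈ s, Finsupp.single j 1 : ℕ →₀ ℕ).support = s := by
    intro s
    ext i
    simp [Finsupp.finsetSum_apply, Finsupp.single_apply]
  have : Subsingleton
      {s : {s : Finset ℕ // s.card = n} // ∑ j ∈ s.1, Finsupp.single j 1 = d} := by
    refine ⟨fun s t => Subtype.ext (Subtype.ext ?_)⟩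
    rw [← key s.1.1, ← key t.1.1, s.2, t.2]
  infer_instance

end

/-! Coloring sums multiply over disjoint unions, so G may be taken connected. Suppose first that G
contains a triangle. Paw-freeness spreads triangles along edges and makes every edge dominating
(`PawFree.adj_or_adj`). A vertex with two non-neighbors would then produce a claw, so the complement
of G is a matching (`ClawFree.eq_of_not_adj`). If G has no triangle, claw-freeness bounds the
degrees by two, and G is a path or a cycle.

Paths and cycles are colored by words. Moving letters into a set of forbidden first letters gives
P_n = e_n + ∑ i e_{i+1} P_{n-1-i} (`pathSum_eq`) and C_n = n(n-1) e_n + ∑ i e_{i+1} C_{n-1-i}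
(`cycleSum_eq`). Both recursions have nonnegative coefficients.

For complements of matchings the claim is strengthened so that it can be proved by induction. For q
≤ s, consider the sums M_{q,s} over a q-set S, an s-set T and a proper coloring avoiding S ∪ T. The
graph is built up by adding a dominating vertex or a nonadjacent pair joined to everything else. The
new colors are absorbed into S and T, which expresses the new M_{q,s} through old ones with
coefficients that are nonnegative because q ≤ s. The empty graph gives e_q e_s, and q = s = 0 is the
claim itself.

All identities are proved with finitely many colors. `ePositiveFamilies` transfers them to power
series. -/

noncomputable section

open Finset

/-! ### Words without equal neighboring letters: recursions for paths and cycles. -/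

section ElementarySums

variable {R : Type*} [CommRing R] (x : ℕ → R) (B : Finset ℕ)

/-- The elementary symmetric polynomial of degree `k` in the variables indexed by `B`. -/
def esymmOn (k : ℕ) : R := ∑ S ∈ B.powersetCard k, ∏ i ∈ S, x i

/-- The sum of `x_T * u c` over the `k`-element subsets `T` of `B` and the colors `c` in `B \ T`. -/
def extensionSum (k : ℕ) (u : ℕ → R) : R :=
  ∑ T ∈ B.powersetCard k, (∏ i ∈ T, x i) * ∑ c ∈ B \ T, u c

theorem esymmOn_zero : esymmOn x B 0 = 1 := by simp [esymmOn]

/-- Moving a marked element from outside a `k`-set into it. -/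
theorem sum_powersetCard_sdiff_eq {M : Type*} [AddCommMonoid M] (B : Finset ℕ) (k : ℕ)
    (F : Finset ℕ → ℕ → M) :
    ∑ T ∈ B.powersetCard k, ∑ c ∈ B \ T, F T c =
      ∑ S ∈ B.powersetCard (k + 1), ∑ c ∈ S, F (S.erase c) c := by
  rw [sum_sigma', sum_sigma']
  refine sum_bij' (fun p _ => ⟨insert p.2 p.1, p.2⟩) (fun p _ => ⟨p.1.erase p.2, p.2⟩) ?_ ?_ ?_ ?_ ?_
  · rintro ⟨T, c⟩ h
    simp only [mem_sigma, mem_powersetCard, mem_sdiff] at h ⊢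
    refine ⟨⟨insert_subset h.2.1 h.1.1, ?_⟩, mem_insert_self _ _⟩
    rw [card_insert_of_notMem h.2.2, h.1.2]
  · rintro ⟨T, c⟩ h
    simp only [mem_sigma, mem_powersetCard, mem_sdiff] at h ⊢
    refine ⟨⟨(erase_subset _ _).trans h.1.1, ?_⟩, h.1.1 h.2, notMem_erase _ _⟩
    rw [card_erase_of_mem h.2, h.1.2]; rfl
  · rintro ⟨T, c⟩ h
    simp only [mem_sigma, mem_sdiff] at h
    simp [erase_insert h.2.2]
  · rintro ⟨T, c⟩ h
    simp only [mem_sigma] at h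
    simp [insert_erase h.2]
  · rintro ⟨T, c⟩ h
    simp only [mem_sigma, mem_sdiff] at h
    simp [erase_insert h.2.2]

theorem extensionSum_mul_eq_sum (k : ℕ) (q : ℕ → R) :
    extensionSum x B k (fun c => x c * q c) =
      ∑ S ∈ B.powersetCard (k + 1), (∏ i ∈ S, x i) * ∑ c ∈ S, q c := by
  have h := sum_powersetCard_sdiff_eq B k (fun T c => (∏ i ∈ T, x i) * (x c * q c))
  simp only [extensionSum, mul_sum]
  rw [h]
  refine sum_congr rfl fun S _ => sum_congr rfl fun c hc => ?_
  rw [← mul_prod_erase S x hc]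
  ring

/-- The factor `x c` absorbs `c` into the set. The sum of `q` over the enlarged set S is its sum
over `B` minus its sum over `B \ S`. -/
theorem extensionSum_mul (k : ℕ) (q : ℕ → R) :
    extensionSum x B k (fun c => x c * q c) =
      esymmOn x B (k + 1) * ∑ c ∈ B, q c - extensionSum x B (k + 1) q := by
  rw [extensionSum_mul_eq_sum, esymmOn, extensionSum, sum_mul, ← sum_sub_distrib]
  refine sum_congr rfl fun S hS => ?_
  rw [← sum_sdiff (mem_powersetCard.1 hS).1]
  ring

theorem extensionSum_self (k : ℕ) :
    extensionSum x B k x = (k + 1) * esymmOn x B (k + 1) := by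
  have h := extensionSum_mul_eq_sum x B k (fun _ => 1)
  simp only [mul_one] at h
  rw [h, esymmOn, mul_sum]
  refine sum_congr rfl fun S hS => ?_
  simp [(mem_powersetCard.1 hS).2, mul_comm]

theorem extensionSum_sub (k : ℕ) (u v : ℕ → R) :
    extensionSum x B k (fun c => u c - v c) = extensionSum x B k u - extensionSum x B k v := by
  simp only [extensionSum, sum_sub_distrib, mul_sub]

theorem extensionSum_mul_const (k : ℕ) (u : ℕ → R) (a : R) :
    extensionSum x B k (fun c => u c * a) = extensionSum x B k u * a := by
  simp only [extensionSum, ← sum_mul, ← mul_assoc]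

theorem extensionSum_zero (u : ℕ → R) : extensionSum x B 0 u = ∑ c ∈ B, u c := by
  simp [extensionSum]

theorem extensionSum_congr (k : ℕ) {u v : ℕ → R} (h : ∀ c ∈ B, u c = v c) :
    extensionSum x B k u = extensionSum x B k v :=
  sum_congr rfl fun _ _ => congrArg _ (sum_congr rfl fun c hc => h c (mem_sdiff.1 hc).1)

/-- The weight of the words of length `m + 1` from `c` to `c'` in the alphabet `B` without equal
adjacent letters. -/
def wordSum : ℕ → ℕ → ℕ → R
  | 0, c, c' => if c = c' then x c else 0
  | m + 1, c, c' => x c * ∑ d ∈ B.erase c, wordSum m d c'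

/-- The weight of the words of length `m + 1` that start with `c`. -/
def wordSumFrom (m c : ℕ) : R := ∑ c' ∈ B, wordSum x B m c c'

/-- The weight of the words of length `n` without equal adjacent letters. -/
def pathSum : ℕ → R
  | 0 => 1
  | m + 1 => ∑ c ∈ B, wordSumFrom x B m c

/-- The weight of the words of length `n` without equal cyclically adjacent letters. -/
def cycleSum : ℕ → R
  | 0 => 0
  | m + 1 => ∑ c ∈ B, ∑ c' ∈ B.erase c, wordSum x B m c c'

/-- The weight of the pairs of a `k`-set and a word of length `n` whose first letter is not
in the set. -/
def lollipopSum (k : ℕ) : ℕ → R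
  | 0 => esymmOn x B k
  | m + 1 => extensionSum x B k (wordSumFrom x B m)

/-- The cyclic analogue of `lollipopSum`, for words of length `m + 1`. -/
def closedLollipopSum (k m : ℕ) : R :=
  extensionSum x B k fun c => ∑ c' ∈ B.erase c, wordSum x B m c c'

/-- Peels off the last letter instead of the first; needed for reversing words. -/
theorem wordSum_succ' (m c c' : ℕ) (hc : c ∈ B) (hc' : c' ∈ B) :
    wordSum x B (m + 1) c c' = (∑ d ∈ B.erase c', wordSum x B m c d) * x c' := by
  induction m generalizing c with
  | zero =>
    simp only [wordSum]
    rw [sum_ite_eq', sum_ite_eq]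
    simp only [mem_erase, hc, hc', and_true, ne_comm (a := c')]
    split_ifs <;> simp
  | succ m ih =>
    rw [wordSum, sum_congr rfl fun d hd => ih d (mem_of_mem_erase hd)]
    simp only [wordSum, sum_mul, mul_sum]
    rw [sum_comm]
    exact sum_congr rfl fun _ _ => sum_congr rfl fun _ _ => by ring

theorem wordSum_comm (m c c' : ℕ) (hc : c ∈ B) (hc' : c' ∈ B) :
    wordSum x B m c c' = wordSum x B m c' c := by
  induction m generalizing c c' with
  | zero => simp only [wordSum, eq_comm (a := c)]; split_ifs with h <;> simp [h]
  | succ m ih =>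
    rw [wordSum_succ' x B m c c' hc hc', wordSum, mul_comm]
    congr 1
    exact sum_congr rfl fun d hd => ih c d hc (mem_of_mem_erase hd)

theorem wordSumFrom_zero {c : ℕ} (hc : c ∈ B) : wordSumFrom x B 0 c = x c := by
  simp [wordSumFrom, wordSum, hc]

theorem wordSumFrom_succ (m : ℕ) {c : ℕ} (hc : c ∈ B) :
    wordSumFrom x B (m + 1) c = x c * pathSum x B (m + 1) - x c * wordSumFrom x B m c := by
  simp only [wordSumFrom, wordSum, pathSum]
  rw [← mul_sum, sum_comm, ← mul_sub, ← sum_erase_eq_sub hc]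

theorem lollipopSum_zero_left (n : ℕ) : lollipopSum x B 0 n = pathSum x B n := by
  cases n with
  | zero => exact esymmOn_zero x B
  | succ m => exact extensionSum_zero x B _

/-- Let the first letter c join the set, giving a (k+1)-set S with a marked element c, and a
remaining word that must not start with c. A remaining word starting outside S allows k + 1 choices
of c, one starting inside S allows k. So every word counts k times, and those starting outside S
once more. -/
theorem lollipopSum_succ (k n : ℕ) :
    lollipopSum x B k (n + 1) =
      lollipopSum x B (k + 1) n + k * (esymmOn x B (k + 1) * pathSum x B n) := by
  cases n with
  | zero =>
    simp only [lollipopSum, pathSum]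
    rw [extensionSum_congr x B k fun c hc => wordSumFrom_zero x B hc, extensionSum_self]
    ring
  | succ m =>
    simp only [lollipopSum]
    rw [extensionSum_congr x B k fun c hc => wordSumFrom_succ x B m hc, extensionSum_sub,
      extensionSum_mul_const, extensionSum_self, extensionSum_mul, pathSum]
    ring

theorem lollipopSum_eq (k n : ℕ) :
    lollipopSum x B k n = esymmOn x B (k + n) +
      ∑ i ∈ range n, ((k + i : ℕ) : R) * (esymmOn x B (k + i + 1) * pathSum x B (n - 1 - i)) := by
  induction n generalizing k with
  | zero => simp [lollipopSum]
  | succ n ih =>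
    rw [lollipopSum_succ, ih, sum_range_succ', show k + 1 + n = k + (n + 1) by ring, add_assoc]
    congr 2
    refine sum_congr rfl fun i hi => ?_
    have := mem_range.1 hi
    rw [show k + 1 + i = k + (i + 1) by ring, show n + 1 - 1 - (i + 1) = n - 1 - i by omega]

/-- A closed word is a word whose ends differ. In a word whose ends agree, removing one of the two
equal end letters c leaves a closed word of length m + 1 at c, and the freed factor `x c` moves c
into the set as in `extensionSum_mul`. -/
theorem closedLollipopSum_succ (k m : ℕ) :
    closedLollipopSum x B k (m + 1) + esymmOn x B (k + 1) * cycleSum x B (m + 1) =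
      lollipopSum x B k (m + 2) + closedLollipopSum x B (k + 1) m := by
  have h1 : closedLollipopSum x B k (m + 1) = lollipopSum x B k (m + 2) -
      extensionSum x B k (fun c => wordSum x B (m + 1) c c) := by
    rw [closedLollipopSum, lollipopSum, ← extensionSum_sub]
    exact extensionSum_congr x B k fun c hc => sum_erase_eq_sub hc
  have h2 : extensionSum x B k (fun c => wordSum x B (m + 1) c c) =
      extensionSum x B k (fun c => x c * ∑ d ∈ B.erase c, wordSum x B m c d) := by
    refine extensionSum_congr x B k fun c hc => ?_
    rw [wordSum]
    congr 1
    exact sum_congr rfl fun d hd => wordSum_comm x B m d c (mem_of_mem_erase hd) hc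
  rw [h1, h2, extensionSum_mul, cycleSum, closedLollipopSum]
  ring

theorem closedLollipopSum_eq (k m : ℕ) :
    closedLollipopSum x B k m +
        ∑ i ∈ range m, esymmOn x B (k + i + 1) * cycleSum x B (m - i) =
      ∑ i ∈ range m, lollipopSum x B (k + i) (m + 1 - i) := by
  induction m generalizing k with
  | zero =>
    have h : ∀ c, ∑ c' ∈ B.erase c, wordSum x B 0 c c' = 0 := fun c =>
      sum_eq_zero fun d hd => if_neg (ne_of_mem_erase hd).symm
    simp [closedLollipopSum, h, extensionSum]
  | succ m ih =>
    rw [sum_range_succ', sum_range_succ']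
    have e1 : ∀ i ∈ range m, esymmOn x B (k + (i + 1) + 1) * cycleSum x B (m + 1 - (i + 1)) =
        esymmOn x B (k + 1 + i + 1) * cycleSum x B (m - i) := fun i _ => by
      rw [show k + (i + 1) = k + 1 + i by ring, Nat.add_sub_add_right]
    have e2 : ∀ i ∈ range m, lollipopSum x B (k + (i + 1)) (m + 1 + 1 - (i + 1)) =
        lollipopSum x B (k + 1 + i) (m + 1 - i) := fun i _ => by
      rw [show k + (i + 1) = k + 1 + i by ring, Nat.add_sub_add_right]
    rw [sum_congr rfl e1, sum_congr rfl e2, ← ih]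
    have := closedLollipopSum_succ x B k m
    simp only [add_zero, Nat.sub_zero]
    linear_combination this

theorem sum_esymmOn_mul_cycleSum (n : ℕ) :
    ∑ i ∈ range n, esymmOn x B i * cycleSum x B (n - i) =
      ∑ i ∈ range n, ((i * (i + 1) : ℕ) : R) * (esymmOn x B (i + 1) * pathSum x B (n - 1 - i)) := by
  -- By `lollipopSum_succ`, with L_j = `lollipopSum x B j (n - j)`, the difference (j+1) L_{j+1} - j
  -- L_j equals L_j - j(j+1) e_{j+1} P_{n-1-j}, so the sum telescopes.
  have tele : ∀ j ≤ n, (j : R) * lollipopSum x B j (n - j) +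
      ∑ i ∈ range j, ((i * (i + 1) : ℕ) : R) * (esymmOn x B (i + 1) * pathSum x B (n - 1 - i)) =
      ∑ i ∈ range j, lollipopSum x B i (n - i) := by
    intro j hj
    induction j with
    | zero => simp
    | succ j ih =>
      rw [sum_range_succ, sum_range_succ, ← ih (by omega)]
      have h := lollipopSum_succ x B j (n - 1 - j)
      rw [show n - 1 - j + 1 = n - j by omega] at h
      rw [show n - (j + 1) = n - 1 - j by omega, h]
      push_cast
      ring
  cases n with
  | zero => simp
  | succ m =>
    have h1 := closedLollipopSum_eq x B 0 m
    have h2 := tele (m + 1) le_rfl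
    have h3 : cycleSum x B (m + 1) = closedLollipopSum x B 0 m := by
      rw [closedLollipopSum, extensionSum_zero]; rfl
    rw [sum_range_succ', esymmOn_zero, one_mul, Nat.sub_zero, h3]
    rw [sum_range_succ (fun i => lollipopSum x B i (m + 1 - i)), Nat.sub_self] at h2
    -- The last lollipop term, absent from the closed sum, cancels the boundary term of the
    -- telescope.
    have h4 : lollipopSum x B m (m + 1 - m) = ((m + 1 : ℕ) : R) * lollipopSum x B (m + 1) 0 := by
      rw [Nat.add_sub_cancel_left, lollipopSum_succ]
      simp only [lollipopSum, pathSum]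
      push_cast
      ring
    simp only [zero_add] at h1
    have h5 : ∑ i ∈ range m, esymmOn x B (i + 1) * cycleSum x B (m + 1 - (i + 1)) =
        ∑ i ∈ range m, esymmOn x B (i + 1) * cycleSum x B (m - i) :=
      sum_congr rfl fun i _ => by rw [Nat.add_sub_add_right]
    rw [h5]
    linear_combination h1 - h2 - h4

/-- In generating series, W = E + F W and E C = S W. Hence E (1 - F) C = S (1 - F) W = E S, and the
unit E cancels. -/
theorem cycleSum_eq (n : ℕ) :
    cycleSum x B n = ((n * (n - 1) : ℕ) : R) * esymmOn x B n +
      ∑ i ∈ range n, (i : R) * (esymmOn x B (i + 1) * cycleSum x B (n - 1 - i)) := by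
  let E : PowerSeries R := PowerSeries.mk (esymmOn x B)
  let W : PowerSeries R := PowerSeries.mk (pathSum x B)
  let C : PowerSeries R := PowerSeries.mk (cycleSum x B)
  -- Truncated subtraction gives `F` constant term 0 rather than -1.
  let F : PowerSeries R := PowerSeries.mk fun i => ((i - 1 : ℕ) : R) * esymmOn x B i
  let S : PowerSeries R := PowerSeries.mk fun i => ((i * (i - 1) : ℕ) : R) * esymmOn x B i
  have conv : ∀ (a b : ℕ → R) (n : ℕ), a 0 = 0 →
      PowerSeries.coeff n (PowerSeries.mk a * PowerSeries.mk b) =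
        ∑ i ∈ range n, a (i + 1) * b (n - 1 - i) := by
    intro a b n ha
    rw [PowerSeries.coeff_mul, Nat.sum_antidiagonal_eq_sum_range_succ_mk, sum_range_succ']
    simp only [PowerSeries.coeff_mk, ha, zero_mul, add_zero]
    exact sum_congr rfl fun i _ => by rw [show n - (i + 1) = n - 1 - i by omega]
  have hW : W = E + F * W := by
    ext n
    rw [map_add, conv _ _ _ (by simp)]
    simp only [W, E, PowerSeries.coeff_mk]
    rw [← lollipopSum_zero_left, lollipopSum_eq]
    simp [mul_assoc]
  have hC : E * C = S * W := by
    ext n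
    rw [conv (fun i => ((i * (i - 1) : ℕ) : R) * esymmOn x B i) _ _ (by simp),
      PowerSeries.coeff_mul, Nat.sum_antidiagonal_eq_sum_range_succ_mk, sum_range_succ]
    simp only [C, E, PowerSeries.coeff_mk, Nat.sub_self]
    rw [show cycleSum x B 0 = 0 from rfl, mul_zero, add_zero, sum_esymmOn_mul_cycleSum]
    refine sum_congr rfl fun i _ => ?_
    rw [Nat.add_sub_cancel, mul_comm i, mul_assoc]
  have hE : IsUnit E := by
    rw [PowerSeries.isUnit_iff_constantCoeff]
    simp [E, esymmOn_zero]
  have key : C = S + F * C := by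
    apply hE.mul_left_cancel
    linear_combination (1 - F) * hC + S * hW
  have := congrArg (PowerSeries.coeff n) key
  rw [map_add, conv _ _ _ (by simp)] at this
  simpa [C, S, mul_assoc] using this

theorem pathSum_eq (n : ℕ) :
    pathSum x B n = esymmOn x B n +
      ∑ i ∈ range n, (i : R) * (esymmOn x B (i + 1) * pathSum x B (n - 1 - i)) := by
  rw [← lollipopSum_zero_left, lollipopSum_eq]
  simp

end ElementarySums

/-! ### Absorbing the colors of new vertices into a pair of sets. -/

section TwoSets

variable {R : Type*} [CommRing R] (x : ℕ → R) (B : Finset ℕ)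

/-- The effect on a coloring sum `h`, as a function of the set of available colors, of adding
a vertex adjacent to everything. -/
def addVertexSum (h : Finset ℕ → R) (B : Finset ℕ) : R := ∑ c ∈ B, x c * h (B.erase c)

/-- The effect on a coloring sum `h` of adding two vertices of the same color that are adjacent
to all the others. -/
def addTwinSum (h : Finset ℕ → R) (B : Finset ℕ) : R := ∑ c ∈ B, x c * x c * h (B.erase c)

/-- The sum over the pairs of a `q`-set `S` and an `s`-set `T` with the colors that occur in `S` or
`T` forbidden in `h`. -/
def twoSetSum (q s : ℕ) (h : Finset ℕ → R) (B : Finset ℕ) : R :=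
  ∑ S ∈ B.powersetCard q, ∑ T ∈ B.powersetCard s,
    (∏ i ∈ S, x i) * (∏ i ∈ T, x i) * h (B \ (S ∪ T))

/-- The sum `twoSetSum` with a marked element of `T \ S`. -/
def markedTwoSetSum (q s : ℕ) (h : Finset ℕ → R) (B : Finset ℕ) : R :=
  ∑ S ∈ B.powersetCard q, ∑ T ∈ B.powersetCard s,
    (#(T \ S) : R) * ((∏ i ∈ S, x i) * (∏ i ∈ T, x i) * h (B \ (S ∪ T)))

theorem twoSetSum_comm (q s : ℕ) (h : Finset ℕ → R) :
    twoSetSum x q s h B = twoSetSum x s q h B := by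
  rw [twoSetSum, sum_comm]
  refine sum_congr rfl fun S _ => sum_congr rfl fun T _ => ?_
  rw [union_comm, mul_comm (∏ i ∈ T, x i)]

theorem twoSetSum_add (q s : ℕ) (h h' : Finset ℕ → R) :
    twoSetSum x q s (fun C => h C + h' C) B = twoSetSum x q s h B + twoSetSum x q s h' B := by
  simp only [twoSetSum, mul_add, sum_add_distrib]

theorem sum_sdiff_union_eq_ite {M : Type*} [AddCommMonoid M] (S T : Finset ℕ) (f : ℕ → M) :
    ∑ c ∈ B \ (S ∪ T), f c = ∑ c ∈ B \ T, if c ∉ S then f c else 0 := by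
  rw [← sum_filter]
  refine sum_congr ?_ fun _ _ => rfl
  ext c
  simp only [mem_sdiff, mem_union, mem_filter]
  tauto

/-- The color of the new vertex lies outside S ∪ T; put into T, it becomes the marked element of T \
S. -/
theorem twoSetSum_addVertexSum_eq_marked (q s : ℕ) (h : Finset ℕ → R) :
    twoSetSum x q s (addVertexSum x h) B = markedTwoSetSum x q (s + 1) h B := by
  refine sum_congr rfl fun S _ => ?_
  have := sum_powersetCard_sdiff_eq B s (fun T c => if c ∉ S then
    (∏ i ∈ S, x i) * (∏ i ∈ T, x i) * (x c * h ((B \ (S ∪ T)).erase c)) else 0)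
  simp only [addVertexSum, mul_sum]
  simp only [sum_sdiff_union_eq_ite]
  rw [this]
  refine sum_congr rfl fun T _ => ?_
  rw [← sum_filter, ← sdiff_eq_filter, ← nsmul_eq_mul, ← sum_const]
  refine sum_congr rfl fun c hc => ?_
  have hc' := mem_sdiff.1 hc
  have e : (B \ (S ∪ T.erase c)).erase c = B \ (S ∪ T) := by
    ext d
    simp only [mem_erase, mem_sdiff, mem_union]
    by_cases hd : d = c
    · subst hd; simp [hc'.1]
    · simp [hd]
  rw [e, ← mul_prod_erase T x hc'.1]
  ring

theorem markedTwoSetSum_swap (q s : ℕ) (h : Finset ℕ → R) :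
    markedTwoSetSum x s q h B = ∑ S ∈ B.powersetCard q, ∑ T ∈ B.powersetCard s,
      (#(S \ T) : R) * ((∏ i ∈ S, x i) * (∏ i ∈ T, x i) * h (B \ (S ∪ T))) := by
  rw [markedTwoSetSum, sum_comm]
  refine sum_congr rfl fun S _ => sum_congr rfl fun T _ => ?_
  rw [union_comm, mul_comm (∏ i ∈ T, x i)]

/-- Both sides weight a pair (S, T) by |S ∪ T|. -/
theorem markedTwoSetSum_add (q s : ℕ) (h : Finset ℕ → R) :
    markedTwoSetSum x q s h B + q * twoSetSum x q s h B =
      markedTwoSetSum x s q h B + s * twoSetSum x q s h B := by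
  rw [markedTwoSetSum_swap x B q s h]
  simp only [markedTwoSetSum, twoSetSum, mul_sum, ← sum_add_distrib]
  refine sum_congr rfl fun S hS => sum_congr rfl fun T hT => ?_
  rw [mem_powersetCard] at hS hT
  have h1 := card_sdiff_add_card_inter S T
  have h2 := card_sdiff_add_card_inter T S
  rw [inter_comm, hT.2] at h2
  rw [hS.2] at h1
  have : (#(T \ S) : R) + q = #(S \ T) + s := by
    rw [← h1, ← h2]; push_cast; ring
  rw [← add_mul, ← add_mul, this]

theorem markedTwoSetSum_zero_right (s : ℕ) (h : Finset ℕ → R) :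
    markedTwoSetSum x s 0 h B = 0 := by simp [markedTwoSetSum]

theorem twoSetSum_zero_addVertexSum (s : ℕ) (h : Finset ℕ → R) :
    twoSetSum x 0 s (addVertexSum x h) B = ((s + 1 : ℕ) : R) * twoSetSum x 0 (s + 1) h B := by
  have := markedTwoSetSum_add x B 0 (s + 1) h
  rw [twoSetSum_addVertexSum_eq_marked]
  rw [markedTwoSetSum_zero_right] at this
  simpa using this

/-- The new color is put into T on the left and into S on the right, ending in both cases with a
(q+1)-set and an (s+1)-set. -/
theorem twoSetSum_succ_addVertexSum (q s : ℕ) (h : Finset ℕ → R) :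
    twoSetSum x (q + 1) s (addVertexSum x h) B + ((q + 1 : ℕ) : R) * twoSetSum x (q + 1) (s + 1) h B =
      twoSetSum x q (s + 1) (addVertexSum x h) B +
        ((s + 1 : ℕ) : R) * twoSetSum x (q + 1) (s + 1) h B := by
  rw [twoSetSum_addVertexSum_eq_marked, twoSetSum_comm x B q, twoSetSum_addVertexSum_eq_marked]
  exact markedTwoSetSum_add x B (q + 1) (s + 1) h

/-- The squared variable lets the twin color enter both sets, which yields the weight |S ∩ T|.
Putting a single new color into S yields |S \ T|. Together these are |S| = q + 1. -/
theorem twoSetSum_addTwinSum (q s : ℕ) (h : Finset ℕ → R) :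
    twoSetSum x q s (addTwinSum x h) B + twoSetSum x q (s + 1) (addVertexSum x h) B =
      ((q + 1 : ℕ) : R) * twoSetSum x (q + 1) (s + 1) h B := by
  have h1 : twoSetSum x q s (addTwinSum x h) B =
      ∑ S ∈ B.powersetCard q, ∑ T ∈ B.powersetCard (s + 1), ∑ c ∈ B \ S, if c ∈ T then
        (∏ i ∈ S, x i) * (∏ i ∈ T, x i) * (x c * h (B \ (S ∪ T))) else 0 := by
    refine sum_congr rfl fun S _ => ?_
    have := sum_powersetCard_sdiff_eq B s (fun T c => if c ∉ S then
      (∏ i ∈ S, x i) * (∏ i ∈ T, x i) * (x c * x c * h ((B \ (S ∪ T)).erase c)) else 0)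
    simp only [addTwinSum, mul_sum]
    simp only [sum_sdiff_union_eq_ite]
    rw [this]
    refine sum_congr rfl fun T hT => ?_
    rw [← sum_filter, ← sum_filter]
    refine sum_congr ?_ fun c hc => ?_
    · ext c
      have := (mem_powersetCard.1 hT).1
      simp only [mem_filter, mem_sdiff]
      exact ⟨fun h => ⟨⟨this h.1, h.2⟩, h.1⟩, fun h => ⟨h.2, h.1.2⟩⟩
    · have hc' : c ∈ T := (mem_filter.1 hc).2
      have e : (B \ (S ∪ T.erase c)).erase c = B \ (S ∪ T) := by
        ext d
        simp only [mem_erase, mem_sdiff, mem_union]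
        by_cases hd : d = c
        · subst hd; simp [hc']
        · simp [hd]
      rw [e, ← mul_prod_erase T x hc']
      ring
  have h2 : twoSetSum x q s (addTwinSum x h) B =
      ∑ S ∈ B.powersetCard (q + 1), ∑ T ∈ B.powersetCard (s + 1),
        (#(S ∩ T) : R) * ((∏ i ∈ S, x i) * (∏ i ∈ T, x i) * h (B \ (S ∪ T))) := by
    rw [h1, sum_comm]
    conv_rhs => rw [sum_comm]
    refine sum_congr rfl fun T _ => ?_
    rw [sum_powersetCard_sdiff_eq B q (fun S c => if c ∈ T then
        (∏ i ∈ S, x i) * (∏ i ∈ T, x i) * (x c * h (B \ (S ∪ T))) else 0)]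
    refine sum_congr rfl fun S _ => ?_
    rw [← sum_filter, filter_mem_eq_inter, ← nsmul_eq_mul, ← sum_const]
    refine sum_congr rfl fun c hc => ?_
    have hc' := mem_inter.1 hc
    have e : S.erase c ∪ T = S ∪ T := by
      ext d
      simp only [mem_erase, mem_union]
      by_cases hd : d = c
      · subst hd; simp [hc'.2]
      · simp [hd]
    rw [e, ← mul_prod_erase S x hc'.1]
    ring
  rw [h2, twoSetSum_comm x B q, twoSetSum_addVertexSum_eq_marked, markedTwoSetSum_swap]
  simp only [twoSetSum, mul_sum, ← sum_add_distrib]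
  refine sum_congr rfl fun S hS => sum_congr rfl fun T _ => ?_
  rw [← (mem_powersetCard.1 hS).2, ← card_sdiff_add_card_inter S T]
  push_cast
  ring

end TwoSets

/-! ### Nonnegativity of the two-set recursions. -/

section Closure

variable {R : Type*} [CommRing R] (x : ℕ → R) (P : AddSubmonoid (Finset ℕ → R))

/-- Passing from (q+1, s) to (q, s+1) costs s - q copies of the sum for h, which is nonnegative even
at q = s. So the allowed range grows to q ≤ s + 1. -/
theorem twoSetSum_addVertexSum_mem {h : Finset ℕ → R}
    (hh : ∀ q s, q ≤ s → twoSetSum x q s h ∈ P) (q s : ℕ) (hqs : q ≤ s + 1) :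
    twoSetSum x q s (addVertexSum x h) ∈ P := by
  induction q generalizing s with
  | zero =>
    have : twoSetSum x 0 s (addVertexSum x h) = (s + 1) • twoSetSum x 0 (s + 1) h := by
      ext B; simpa using twoSetSum_zero_addVertexSum x B s h
    rw [this]
    exact P.nsmul_mem (hh _ _ (by omega)) _
  | succ q ih =>
    have : twoSetSum x (q + 1) s (addVertexSum x h) =
        twoSetSum x q (s + 1) (addVertexSum x h) + (s - q) • twoSetSum x (q + 1) (s + 1) h := by
      ext B
      have := twoSetSum_succ_addVertexSum x B q s h
      simp only [Pi.add_apply, Pi.smul_apply]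
      simp only [nsmul_eq_mul]
      rw [Nat.cast_sub (by omega)]
      push_cast at this
      linear_combination this
    rw [this]
    exact P.add_mem (ih _ (by omega)) (P.nsmul_mem (hh _ _ (by omega)) _)

/-- The twin term alone contributes a negative `addVertexSum` term. The term with two different
colors contains enough copies of it to compensate, exactly because q ≤ s. -/
theorem twoSetSum_addPair_mem {h : Finset ℕ → R}
    (hh : ∀ q s, q ≤ s → twoSetSum x q s h ∈ P) (q s : ℕ) (hqs : q ≤ s) :
    twoSetSum x q s (fun B => addTwinSum x h B + addVertexSum x (addVertexSum x h) B) ∈ P := by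
  have h1 : ∀ q s, q ≤ s + 1 → twoSetSum x q s (addVertexSum x h) ∈ P :=
    twoSetSum_addVertexSum_mem x P hh
  have h2 : ∀ q s, q ≤ s + 1 → twoSetSum x q s (addVertexSum x (addVertexSum x h)) ∈ P :=
    twoSetSum_addVertexSum_mem x P fun q s hq => h1 q s (by omega)
  cases q with
  | zero =>
    have : twoSetSum x 0 s (fun B => addTwinSum x h B + addVertexSum x (addVertexSum x h) B) =
        1 • twoSetSum x 1 (s + 1) h + s • twoSetSum x 0 (s + 1) (addVertexSum x h) := by
      ext B
      have e1 := twoSetSum_addTwinSum x B 0 s h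
      have e2 := twoSetSum_zero_addVertexSum x B s (addVertexSum x h)
      rw [twoSetSum_add]
      simp only [Pi.add_apply, Pi.smul_apply]
      simp only [nsmul_eq_mul]
      push_cast at e1 e2 ⊢
      linear_combination e1 + e2
    rw [this]
    exact P.add_mem (P.nsmul_mem (hh _ _ (by omega)) _) (P.nsmul_mem (h1 _ _ (by omega)) _)
  | succ q =>
    have : twoSetSum x (q + 1) s
        (fun B => addTwinSum x h B + addVertexSum x (addVertexSum x h) B) =
        (q + 2) • twoSetSum x (q + 2) (s + 1) h +
        (s - (q + 1)) • twoSetSum x (q + 1) (s + 1) (addVertexSum x h) +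
        twoSetSum x q (s + 1) (addVertexSum x (addVertexSum x h)) := by
      ext B
      have e1 := twoSetSum_addTwinSum x B (q + 1) s h
      have e2 := twoSetSum_succ_addVertexSum x B q s (addVertexSum x h)
      rw [twoSetSum_add]
      simp only [Pi.add_apply, Pi.smul_apply]
      simp only [nsmul_eq_mul]
      rw [Nat.cast_sub (by omega)]
      push_cast at e1 e2 ⊢
      linear_combination e1 + e2
    rw [this]
    exact P.add_mem (P.add_mem (P.nsmul_mem (hh _ _ (by omega)) _)
      (P.nsmul_mem (h1 _ _ (by omega)) _)) (h2 _ _ (by omega))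

end Closure

/-! ### Coloring sums with lists: deleting a vertex and disjoint unions. -/

section ListColorings

theorem mem_piFinset_iff {V : Type*} [Fintype V] {inst : DecidableEq V} {L : V → Finset ℕ}
    {κ : V → ℕ} : κ ∈ @Fintype.piFinset V inst _ _ L ↔ ∀ v, κ v ∈ L v :=
  Fintype.mem_piFinset

variable {R : Type*} [CommRing R] (x : ℕ → R) {V W : Type*} [Fintype V] [Fintype W]

open Classical in
/-- The sum of the monomials of the proper colorings of `G` that color `v` from the list `L v`. -/
def listColoringSum (G : SimpleGraph V) (L : V → Finset ℕ) : R :=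
  ∑ κ ∈ Fintype.piFinset L, if ∀ u v, G.Adj u v → κ u ≠ κ v then ∏ v, x (κ v) else 0

theorem listColoringSum_comap_equiv (G : SimpleGraph V) (L : V → Finset ℕ) (e : W ≃ V) :
    listColoringSum x (G.comap e) (fun w => L (e w)) = listColoringSum x G L := by
  classical
  refine sum_bij' (fun κ _ v => κ (e.symm v)) (fun κ _ w => κ (e w)) ?_ ?_ ?_ ?_ ?_
  · intro κ h
    rw [mem_piFinset_iff] at h ⊢
    intro v
    simpa using h (e.symm v)
  · intro κ h
    rw [mem_piFinset_iff] at h ⊢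
    exact fun w => h (e w)
  · intro κ _; simp
  · intro κ _; simp
  · intro κ _
    have h1 : (∀ u v, (G.comap e).Adj u v → κ u ≠ κ v) ↔
        ∀ u v, G.Adj u v → κ (e.symm u) ≠ κ (e.symm v) := by
      refine ⟨fun h u v huv => h _ _ (by simpa using huv), fun h u v huv => ?_⟩
      simpa using h (e u) (e v) huv
    exact if_congr h1 (Equiv.prod_comp e.symm fun w => x (κ w)).symm rfl

theorem listColoringSum_isEmpty [IsEmpty V] (G : SimpleGraph V) (L : V → Finset ℕ) :
    listColoringSum x G L = 1 := by
  classical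
  simp [listColoringSum]

theorem listColoringSum_option (G : SimpleGraph (Option W)) (L : Option W → Finset ℕ)
    (L' : ℕ → W → Finset ℕ) (hL : ∀ c ∈ L none, ∀ w d,
      d ∈ L' c w ↔ d ∈ L (some w) ∧ (G.Adj none (some w) → d ≠ c)) :
    listColoringSum x G L = ∑ c ∈ L none, x c * listColoringSum x (G.comap some) (L' c) := by
  classical
  have h1 : listColoringSum x G L = ∑ c ∈ L none, ∑ κ ∈ Fintype.piFinset fun w => L (some w),
      if (∀ u v, G.Adj (some u) (some v) → κ u ≠ κ v) ∧ ∀ w, G.Adj none (some w) → κ w ≠ c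
      then x c * ∏ w, x (κ w) else 0 := by
    rw [sum_sigma', listColoringSum]
    refine sum_bij' (fun κ _ => ⟨κ none, fun w => κ (some w)⟩)
      (fun p _ o => o.elim p.1 p.2) ?_ ?_ ?_ ?_ ?_
    · intro κ h
      rw [mem_piFinset_iff] at h
      rw [mem_sigma, mem_piFinset_iff]
      exact ⟨h none, fun w => h (some w)⟩
    · rintro ⟨c, κ⟩ h
      rw [mem_sigma, mem_piFinset_iff] at h
      rw [mem_piFinset_iff]
      rintro (_ | w)
      · exact h.1
      · exact h.2 w
    · intro κ _
      funext o
      cases o <;> rfl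
    · rintro ⟨c, κ⟩ _; rfl
    · intro κ _
      refine if_congr ?_ (Fintype.prod_option _) rfl
      constructor
      · exact fun h => ⟨fun u v => h _ _, fun w hw => (h _ _ hw).symm⟩
      · rintro ⟨h, h'⟩ (_ | u) (_ | v) huv
        · exact absurd huv (G.irrefl)
        · exact (h' v huv).symm
        · exact h' u huv.symm
        · exact h u v huv
  rw [h1]
  refine sum_congr rfl fun c hc => ?_
  rw [listColoringSum, mul_sum, ← sum_filter]
  simp only [mul_ite, mul_zero]
  rw [← sum_filter]
  refine sum_congr ?_ fun _ _ => rfl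
  ext κ
  simp only [mem_filter, mem_piFinset_iff, SimpleGraph.comap_adj, hL c hc, forall_and]
  tauto

/-- Sorting the colorings by the color of the vertex `e none`. -/
theorem listColoringSum_peel (G : SimpleGraph V) (L : V → Finset ℕ) (e : Option W ≃ V)
    (L' : ℕ → W → Finset ℕ) (hL : ∀ c ∈ L (e none), ∀ w d,
      d ∈ L' c w ↔ d ∈ L (e (some w)) ∧ (G.Adj (e none) (e (some w)) → d ≠ c)) :
    listColoringSum x G L =
      ∑ c ∈ L (e none), x c * listColoringSum x (G.comap fun w => e (some w)) (L' c) := by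
  rw [← listColoringSum_comap_equiv x G L e, listColoringSum_option x _ _ L' hL]
  rfl

theorem listColoringSum_sum (G : SimpleGraph (V ⊕ W)) (L : V ⊕ W → Finset ℕ)
    (h : ∀ v w, ¬ G.Adj (Sum.inl v) (Sum.inr w)) :
    listColoringSum x G L =
      listColoringSum x (G.comap Sum.inl) (fun v => L (Sum.inl v)) *
        listColoringSum x (G.comap Sum.inr) (fun w => L (Sum.inr w)) := by
  classical
  rw [listColoringSum, listColoringSum, listColoringSum, sum_mul_sum, sum_sigma']
  refine sum_bij' (fun κ _ => ⟨fun v => κ (Sum.inl v), fun w => κ (Sum.inr w)⟩)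
    (fun p _ => Sum.elim p.1 p.2) ?_ ?_ ?_ ?_ ?_
  · intro κ hκ
    rw [mem_piFinset_iff] at hκ
    rw [mem_sigma, mem_piFinset_iff, mem_piFinset_iff]
    exact ⟨fun v => hκ _, fun w => hκ _⟩
  · rintro ⟨κ, κ'⟩ hκ
    rw [mem_sigma, mem_piFinset_iff, mem_piFinset_iff] at hκ
    rw [mem_piFinset_iff]
    rintro (v | w)
    · exact hκ.1 v
    · exact hκ.2 w
  · intro κ _
    funext o
    cases o <;> rfl
  · rintro ⟨κ, κ'⟩ _; rfl
  · intro κ _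
    refine Eq.trans (if_congr ?_ (Fintype.prod_sum_type _) rfl) (ite_zero_mul_ite_zero ..).symm
    constructor
    · exact fun h => ⟨fun u v => h _ _, fun u v => h _ _⟩
    · rintro ⟨h1, h2⟩ (u | u) (v | v) huv
      · exact h1 u v huv
      · exact absurd huv (h u v)
      · exact absurd huv.symm (h v u)
      · exact h2 u v huv

theorem listColoringSum_mul_of_forall_not_adj (G : SimpleGraph V) (L : V → Finset ℕ)
    (p : V → Prop) [DecidablePred p] (h : ∀ u v, p u → ¬ p v → ¬ G.Adj u v) :
    listColoringSum x G L =
      listColoringSum x (G.comap (Subtype.val : {v // p v} → V)) (fun v => L v) *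
        listColoringSum x (G.comap (Subtype.val : {v // ¬ p v} → V)) (fun v => L v) := by
  rw [← listColoringSum_comap_equiv x G L (Equiv.sumCompl p), listColoringSum_sum]
  · rfl
  · intro v w
    exact h v w v.2 w.2

end ListColorings

/-! ### Colorings of paths and cycles as words. -/

section PathsAndCycles

variable {R : Type*} [CommRing R] (x : ℕ → R) (B : Finset ℕ)

theorem pathGraph_comap_succ (m : ℕ) :
    (SimpleGraph.pathGraph (m + 2)).comap Fin.succ = SimpleGraph.pathGraph (m + 1) := by
  ext i j
  simp only [SimpleGraph.comap_adj, SimpleGraph.pathGraph_adj, Fin.val_succ]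
  omega

/-- Restricted lists at both ends let the induction peel off the first vertex, whose color c turns
the next list into `B.erase c`. The lists are intersections because the two ends coincide when m =
0. -/
theorem listColoringSum_pathGraph (m : ℕ) {A A' : Finset ℕ} (hA : A ⊆ B) :
    listColoringSum x (SimpleGraph.pathGraph (m + 1))
      (fun i => (if i = 0 then A else B) ∩ (if i = Fin.last m then A' else B)) =
      ∑ c ∈ A, ∑ c' ∈ A', wordSum x B m c c' := by
  induction m generalizing A with
  | zero =>
    rw [listColoringSum_peel x _ _ (finSuccEquiv 0).symm (fun _ _ => ∅) (fun _ _ w => w.elim0)]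
    simp only [listColoringSum_isEmpty, finSuccEquiv_symm_none, if_true, mul_one, wordSum,
      sum_ite_eq, ← sum_filter, filter_mem_eq_inter, Fin.last_zero]
  | succ m ih =>
    have h0 : (0 : Fin (m + 2)) ≠ Fin.last (m + 1) := (Fin.last_pos).ne
    rw [listColoringSum_peel x _ _ (finSuccEquiv (m + 1)).symm
      (fun c i => (if i = 0 then B.erase c else B) ∩ (if i = Fin.last m then A' else B))]
    · simp only [finSuccEquiv_symm_none, finSuccEquiv_symm_some, if_true, if_neg h0,
        inter_eq_left.2 hA, pathGraph_comap_succ]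
      refine sum_congr rfl fun c _ => ?_
      simp only [wordSum, ← mul_sum]
      rw [sum_comm, ← ih (erase_subset c B)]
    · intro c _ i d
      have h1 : (SimpleGraph.pathGraph (m + 1 + 1)).Adj 0 i.succ ↔ i = 0 := by
        rw [SimpleGraph.pathGraph_adj, Fin.ext_iff]
        simp
      have h2 : i.succ = Fin.last (m + 1) ↔ i = Fin.last m := by
        rw [← Fin.succ_last, Fin.succ_inj]
      simp only [finSuccEquiv_symm_none, finSuccEquiv_symm_some, h1, h2, Fin.succ_ne_zero, if_false]
      split_ifs <;> simp_all [and_comm]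

theorem listColoringSum_pathGraph_eq_pathSum (n : ℕ) :
    listColoringSum x (SimpleGraph.pathGraph n) (fun _ => B) = pathSum x B n := by
  cases n with
  | zero => exact listColoringSum_isEmpty x _ _
  | succ m =>
    have := listColoringSum_pathGraph x B m (A' := B) (subset_refl B)
    simp only [ite_self, inter_self] at this
    exact this

/-- Deleting vertex 0, of color c, leaves a path with c forbidden at both ends. For m = 0 the cycle
degenerates to a single edge. -/
theorem listColoringSum_eq_cycleSum (m : ℕ) (G : SimpleGraph (Fin (m + 2)))
    (hG : ∀ i j, G.Adj i j ↔ (SimpleGraph.pathGraph (m + 2)).Adj i j ∨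
      (i = 0 ∧ j = Fin.last (m + 1)) ∨ (j = 0 ∧ i = Fin.last (m + 1))) :
    listColoringSum x G (fun _ => B) = cycleSum x B (m + 2) := by
  rw [listColoringSum_peel x _ _ (finSuccEquiv (m + 1)).symm (fun c i =>
    (if i = 0 then B.erase c else B) ∩ (if i = Fin.last m then B.erase c else B))]
  · simp only [finSuccEquiv_symm_some]
    refine sum_congr rfl fun c _ => ?_
    simp only [wordSum, ← mul_sum]
    have h0 : G.comap Fin.succ = SimpleGraph.pathGraph (m + 1) := by
      rw [← pathGraph_comap_succ]
      ext i j
      simp [hG, Fin.succ_ne_zero]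
    rw [sum_comm, ← listColoringSum_pathGraph x B m (erase_subset c B), h0]
  · intro c _ i d
    have h1 : G.Adj 0 i.succ ↔ i = 0 ∨ i = Fin.last m := by
      rw [hG, SimpleGraph.pathGraph_adj, ← Fin.succ_last, Fin.succ_inj, Fin.ext_iff (b := 0)]
      simp [Fin.succ_ne_zero]
    simp only [finSuccEquiv_symm_none, finSuccEquiv_symm_some, h1]
    split_ifs <;> simp_all [and_comm]

end PathsAndCycles

/-! ### The semiring of e-positive functions and passage to finitely many colors. -/

section EPositivity

theorem IsEPositive.zero : IsEPositive 0 := ⟨0, fun _ => le_rfl, by simp⟩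

theorem IsEPositive.smul_elemSymmPart {a : ℚ} (ha : 0 ≤ a) {n : ℕ} (lam : n.Partition) :
    IsEPositive (a • elemSymmPart lam) := by
  classical
  refine ⟨Finsupp.single ⟨n, lam⟩ a, fun p => ?_, ?_⟩
  · rw [Finsupp.single_apply]
    split_ifs
    · exact ha
    · exact le_rfl
  · rw [Finsupp.sum_single_index]
    exact zero_smul _ _

theorem IsEPositive.add {f g : MvPowerSeries ℕ ℚ} (hf : IsEPositive f) (hg : IsEPositive g) :
    IsEPositive (f + g) := by
  obtain ⟨c, hc, rfl⟩ := hf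
  obtain ⟨c', hc', rfl⟩ := hg
  refine ⟨c + c', fun p => add_nonneg (hc p) (hc' p), ?_⟩
  rw [Finsupp.sum_add_index']
  · exact fun p => zero_smul _ _
  · exact fun p a b => add_smul _ _ _

theorem IsEPositive.sum {ι : Type*} (s : Finset ι) (f : ι → MvPowerSeries ℕ ℚ)
    (hf : ∀ i ∈ s, IsEPositive (f i)) : IsEPositive (∑ i ∈ s, f i) :=
  sum_induction f IsEPositive (fun _ _ => IsEPositive.add) IsEPositive.zero hf

theorem elemSymm_zero : elemSymm 0 = 1 := by
  ext d
  rw [MvPowerSeries.coeff_one]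
  show ((Nat.card {i : {s : Finset ℕ // s.card = 0} // ∑ j ∈ i.1, Finsupp.single j 1 = d} : ℕ) : ℚ)
    = _
  split_ifs with h
  · have : Unique {i : {s : Finset ℕ // s.card = 0} // ∑ j ∈ i.1, Finsupp.single j 1 = d} :=
      { default := ⟨⟨∅, rfl⟩, by simp [h]⟩
        uniq := by
          rintro ⟨⟨s, hs⟩, h⟩
          simp only [Finset.card_eq_zero] at hs
          subst hs
          rfl }
    simp
  · have : IsEmpty {i : {s : Finset ℕ // s.card = 0} // ∑ j ∈ i.1, Finsupp.single j 1 = d} := by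
      refine ⟨?_⟩
      rintro ⟨⟨s, hs⟩, h'⟩
      simp only [Finset.card_eq_zero] at hs
      subst hs
      exact h (by simpa using h'.symm)
    simp

/-- `Nat.Partition.ofSums` discards zero parts, which is harmless since e_0 = 1. -/
theorem prod_map_elemSymm_eq_elemSymmPart (m : Multiset ℕ) :
    (m.map elemSymm).prod = elemSymmPart (Nat.Partition.ofSums m.sum m rfl) := by
  rw [elemSymmPart]
  change _ = ((m.filter (· ≠ 0)).map elemSymm).prod
  induction m using Multiset.induction_on with
  | empty => simp
  | cons a m ih =>
    by_cases ha : a = 0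
    · subst ha; simp [ih, elemSymm_zero]
    · simp [ih, ha]

theorem IsEPositive.smul_prod {a : ℚ} (ha : 0 ≤ a) (m : Multiset ℕ) :
    IsEPositive (a • (m.map elemSymm).prod) := by
  rw [prod_map_elemSymm_eq_elemSymmPart]
  exact IsEPositive.smul_elemSymmPart ha _

theorem IsEPositive.one : IsEPositive 1 := by
  simpa using IsEPositive.smul_prod zero_le_one 0

theorem IsEPositive.elemSymm (n : ℕ) : IsEPositive (elemSymm n) := by
  simpa using IsEPositive.smul_prod zero_le_one {n}

theorem IsEPositive.mul {f g : MvPowerSeries ℕ ℚ} (hf : IsEPositive f) (hg : IsEPositive g) :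
    IsEPositive (f * g) := by
  obtain ⟨c, hc, rfl⟩ := hf
  obtain ⟨c', hc', rfl⟩ := hg
  rw [Finsupp.sum, Finsupp.sum, sum_mul_sum]
  refine IsEPositive.sum _ _ fun p _ => IsEPositive.sum _ _ fun p' _ => ?_
  have := IsEPositive.smul_prod (mul_nonneg (hc p) (hc' p')) (p.2.parts + p'.2.parts)
  rwa [Multiset.map_add, Multiset.prod_add, ← smul_mul_smul_comm] at this

/-- The families of polynomials, indexed by finite sets of variables, that are the restrictions
of an e-positive power series. -/
def ePositiveFamilies : Subsemiring (Finset ℕ → MvPolynomial ℕ ℚ) where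
  carrier := {f | ∃ F, IsEPositive F ∧ ∀ (C : Finset ℕ) (d : ℕ →₀ ℕ), d.support ⊆ C →
    MvPowerSeries.coeff d F = (f C).coeff d}
  zero_mem' := ⟨0, IsEPositive.zero, fun C d _ => by simp⟩
  one_mem' := ⟨1, IsEPositive.one, fun C d _ => by
    classical
    rw [MvPowerSeries.coeff_one, Pi.one_apply, MvPolynomial.coeff_one]
    simp only [eq_comm]⟩
  add_mem' := by
    rintro f g ⟨F, hF, hf⟩ ⟨F', hF', hg⟩
    refine ⟨F + F', hF.add hF', fun C d hd => ?_⟩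
    rw [map_add, Pi.add_apply, MvPolynomial.coeff_add, hf C d hd, hg C d hd]
  mul_mem' := by
    classical
    rintro f g ⟨F, hF, hf⟩ ⟨F', hF', hg⟩
    refine ⟨F * F', hF.mul hF', fun C d hd => ?_⟩
    rw [MvPowerSeries.coeff_mul, Pi.mul_apply, MvPolynomial.coeff_mul]
    -- Both factors of a monomial supported in `C` are supported in `C`.
    refine sum_congr rfl fun p hp => ?_
    have hp := mem_antidiagonal.1 hp
    rw [hf C p.1 ((Finsupp.support_mono (hp ▸ le_self_add)).trans hd),
      hg C p.2 ((Finsupp.support_mono (hp ▸ le_add_self)).trans hd)]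

theorem support_sum_single (s : Finset ℕ) :
    (∑ j ∈ s, Finsupp.single j 1 : ℕ →₀ ℕ).support = s := by
  ext i
  simp [Finsupp.finsetSum_apply, Finsupp.single_apply]

theorem coeff_esymmOn (n : ℕ) (C : Finset ℕ) (d : ℕ →₀ ℕ) (hd : d.support ⊆ C) :
    MvPowerSeries.coeff d (elemSymm n) = (esymmOn MvPolynomial.X C n : MvPolynomial ℕ ℚ).coeff d := by
  classical
  have h1 : ∀ S : Finset ℕ, (∏ i ∈ S, MvPolynomial.X i : MvPolynomial ℕ ℚ) =
      MvPolynomial.monomial (∑ j ∈ S, Finsupp.single j 1) 1 := fun S => by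
    rw [MvPolynomial.monomial_sum_one]; rfl
  simp only [esymmOn, h1, MvPolynomial.coeff_sum, MvPolynomial.coeff_monomial]
  rw [sum_boole]
  change ((Nat.card _ : ℕ) : ℚ) = _
  congr 1
  rw [← Fintype.card_coe, ← Nat.card_eq_fintype_card]
  refine Nat.card_congr ⟨fun p => ⟨p.1.1, ?_⟩, fun p => ⟨⟨p.1, ?_⟩, ?_⟩, fun _ => rfl, fun _ => rfl⟩
  · refine mem_filter.2 ⟨mem_powersetCard.2 ⟨?_, p.1.2⟩, p.2⟩
    have h := p.2
    dsimp only at h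
    rw [← support_sum_single p.1.1, h]
    exact hd
  · exact (mem_powersetCard.1 (mem_filter.1 p.2).1).2
  · exact (mem_filter.1 p.2).2

theorem coeff_listColoringSum {V : Type*} [Fintype V] (G : SimpleGraph V) (C : Finset ℕ)
    (d : ℕ →₀ ℕ) (hd : d.support ⊆ C) :
    MvPowerSeries.coeff d (chromaticSymmetricFunction G) =
      (listColoringSum MvPolynomial.X G (fun _ => C) : MvPolynomial ℕ ℚ).coeff d := by
  classical
  have h1 : ∀ κ : V → ℕ, (∏ v, MvPolynomial.X (κ v) : MvPolynomial ℕ ℚ) =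
      MvPolynomial.monomial (colorExponent κ) 1 := fun κ => by
    rw [colorExponent, MvPolynomial.monomial_sum_one]; rfl
  rw [listColoringSum, ← sum_filter]
  simp only [h1, MvPolynomial.coeff_sum, MvPolynomial.coeff_monomial]
  rw [sum_boole]
  change ((Nat.card _ : ℕ) : ℚ) = _
  congr 1
  rw [← Fintype.card_coe, ← Nat.card_eq_fintype_card]
  refine Nat.card_congr ⟨fun p => ⟨p.1, ?_⟩, fun p => ⟨⟨p.1, ?_⟩, ?_⟩, fun _ => rfl, fun _ => rfl⟩
  · refine mem_filter.2 ⟨mem_filter.2 ⟨mem_piFinset_iff.2 fun v => hd ?_, fun u v h => p.1.valid h⟩,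
      p.2⟩
    have h := Finsupp.mem_support_iff.2 (colorExponent_apply_pos p.1 v).ne'
    rwa [show colorExponent p.1 = d from p.2] at h
  · exact fun {u v} h => (mem_filter.1 (mem_filter.1 p.2).1).2 u v h
  · exact (mem_filter.1 p.2).2

theorem esymmOn_mem_ePositiveFamilies (n : ℕ) :
    (fun C => esymmOn MvPolynomial.X C n) ∈ ePositiveFamilies :=
  ⟨elemSymm n, IsEPositive.elemSymm n, coeff_esymmOn n⟩

theorem isEPositive_of_listColoringSum_mem {V : Type*} [Fintype V] (G : SimpleGraph V)
    (h : (fun C => listColoringSum MvPolynomial.X G (fun _ => C)) ∈ ePositiveFamilies) :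
    IsEPositive (chromaticSymmetricFunction G) := by
  obtain ⟨F, hF, h⟩ := h
  have : chromaticSymmetricFunction G = F := by
    ext d
    -- Only the colors occurring in `d` matter for its coefficient.
    rw [h d.support d subset_rfl, coeff_listColoringSum G _ d subset_rfl]
  rwa [this]

theorem pathSum_mem_ePositiveFamilies (n : ℕ) :
    (fun C => pathSum MvPolynomial.X C n) ∈ ePositiveFamilies := by
  induction n using Nat.strong_induction_on with
  | _ n ih =>
    have : (fun C => pathSum MvPolynomial.X C n : Finset ℕ → MvPolynomial ℕ ℚ) =
        (fun C => esymmOn MvPolynomial.X C n) + ∑ i ∈ range n, (i : Finset ℕ → MvPolynomial ℕ ℚ) *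
          ((fun C => esymmOn MvPolynomial.X C (i + 1)) *
            fun C => pathSum MvPolynomial.X C (n - 1 - i)) := by
      funext C
      simp [pathSum_eq MvPolynomial.X C n]
    rw [this]
    refine add_mem (esymmOn_mem_ePositiveFamilies n) (sum_mem fun i hi => mul_mem (natCast_mem _ _)
      (mul_mem (esymmOn_mem_ePositiveFamilies _) (ih _ ?_)))
    have := mem_range.1 hi
    omega

theorem cycleSum_mem_ePositiveFamilies (n : ℕ) :
    (fun C => cycleSum MvPolynomial.X C n) ∈ ePositiveFamilies := by
  induction n using Nat.strong_induction_on with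
  | _ n ih =>
    have : (fun C => cycleSum MvPolynomial.X C n : Finset ℕ → MvPolynomial ℕ ℚ) =
        ((n * (n - 1) : ℕ) : Finset ℕ → MvPolynomial ℕ ℚ) * (fun C => esymmOn MvPolynomial.X C n) +
        ∑ i ∈ range n, (i : Finset ℕ → MvPolynomial ℕ ℚ) *
          ((fun C => esymmOn MvPolynomial.X C (i + 1)) *
            fun C => cycleSum MvPolynomial.X C (n - 1 - i)) := by
      funext C
      simp [cycleSum_eq MvPolynomial.X C n]
    rw [this]
    refine add_mem (mul_mem (natCast_mem _ _) (esymmOn_mem_ePositiveFamilies n))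
      (sum_mem fun i hi => mul_mem (natCast_mem _ _)
      (mul_mem (esymmOn_mem_ePositiveFamilies _) (ih _ ?_)))
    have := mem_range.1 hi
    omega

end EPositivity

/-! ### Graphs whose complement is a matching. -/

section ComplementsOfMatchings

variable {V : Type*} [Fintype V]

theorem listColoringSum_eq_addVertexSum {R : Type*} [CommRing R] (x : ℕ → R) (G : SimpleGraph V)
    {W : Type*} [Fintype W] (e : Option W ≃ V) (h : ∀ w, G.Adj (e none) (e (some w))) :
    (fun C => listColoringSum x G (fun _ => C)) =
      addVertexSum x fun C => listColoringSum x (G.comap fun w => e (some w)) (fun _ => C) := by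
  funext C
  rw [listColoringSum_peel x G _ e fun c _ => C.erase c, addVertexSum]
  simp [h, and_comm]

theorem listColoringSum_eq_addPair {R : Type*} [CommRing R] (x : ℕ → R) (G : SimpleGraph V)
    {W : Type*} [Fintype W] (e : Option (Option W) ≃ V)
    (h0 : ¬ G.Adj (e none) (e (some none)))
    (h1 : ∀ w, G.Adj (e none) (e (some (some w))))
    (h2 : ∀ w, G.Adj (e (some none)) (e (some (some w)))) :
    (fun C => listColoringSum x G (fun _ => C)) = fun C =>
      addTwinSum x (fun C =>
        listColoringSum x (G.comap fun w => e (some (some w))) (fun _ => C)) C +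
      addVertexSum x (addVertexSum x fun C =>
        listColoringSum x (G.comap fun w => e (some (some w))) (fun _ => C)) C := by
  funext C
  rw [listColoringSum_peel x G _ e fun c w => w.elim C fun _ => C.erase c]
  · rw [addTwinSum, addVertexSum, ← sum_add_distrib]
    refine sum_congr rfl fun c hc => ?_
    rw [listColoringSum_peel x _ _ (Equiv.refl (Option W)) fun c' _ => (C.erase c).erase c']
    · simp only [Equiv.refl_apply, Option.elim_none]
      -- The second vertex of the pair either repeats the color `c` of the first or takes another
      -- one.
      rw [← add_sum_erase C _ hc, erase_idem, addVertexSum, mul_add, mul_assoc]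
      rfl
    · intro c' _ w d
      have := h2 w
      simp [this, and_comm]
  · rintro c _ (_ | w) d
    · simp [h0]
    · simp [h1, and_comm]

/-- A vertex v is either adjacent to all others or has a unique non-neighbor u. In the second case v
and u are both joined to everything else and are removed together. -/
theorem twoSetSum_listColoringSum_mem (G : SimpleGraph V)
    (hG : ∀ v u w, u ≠ v → w ≠ v → ¬ G.Adj v u → ¬ G.Adj v w → u = w) (q s : ℕ) (hqs : q ≤ s) :
    twoSetSum MvPolynomial.X q s (fun C => listColoringSum MvPolynomial.X G (fun _ => C)) ∈
      ePositiveFamilies := by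
  classical
  induction hn : Fintype.card V using Nat.strong_induction_on generalizing V q s with
  | _ n ih =>
    rcases isEmpty_or_nonempty V with hV | ⟨⟨v⟩⟩
    · have : twoSetSum MvPolynomial.X q s
          (fun C => listColoringSum MvPolynomial.X G (fun _ => C) :
            Finset ℕ → MvPolynomial ℕ ℚ) =
          (fun C => esymmOn MvPolynomial.X C q) * fun C => esymmOn MvPolynomial.X C s := by
        funext C
        simp only [twoSetSum, listColoringSum_isEmpty, mul_one, Pi.mul_apply, esymmOn, sum_mul_sum]
      rw [this]
      exact mul_mem (esymmOn_mem_ePositiveFamilies q) (esymmOn_mem_ePositiveFamilies s)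
    · have hcomap : ∀ {W : Type _} (f : W → V), Function.Injective f →
          ∀ v u w, u ≠ v → w ≠ v → ¬ (G.comap f).Adj v u → ¬ (G.comap f).Adj v w → u = w :=
        fun f hf v u w hu hw h1 h2 => hf (hG _ _ _ (hf.ne hu) (hf.ne hw) h1 h2)
      by_cases hv : ∀ w, w ≠ v → G.Adj v w
      · let e := Equiv.optionSubtypeNe v
        rw [listColoringSum_eq_addVertexSum _ G e fun w => by simpa [e] using hv w w.2]
        refine twoSetSum_addVertexSum_mem _ ePositiveFamilies.toAddSubmonoid
          (fun q s hqs => ih _ ?_ _ (hcomap _ ?_) q s hqs rfl) q s (by omega)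
        · rw [← hn, ← Fintype.card_congr e, Fintype.card_option]
          exact Nat.lt_succ_self _
        · exact e.injective.comp (Option.some_injective _)
      · push Not at hv
        obtain ⟨u, huv, hu⟩ := hv
        let e : Option (Option {w : {w // w ≠ v} // w ≠ ⟨u, huv⟩}) ≃ V :=
          (Equiv.optionCongr (Equiv.optionSubtypeNe ⟨u, huv⟩)).trans (Equiv.optionSubtypeNe v)
        have e1 : e none = v := by simp [e]
        have e2 : e (some none) = u := by simp [e]
        rw [listColoringSum_eq_addPair _ G e]
        · refine twoSetSum_addPair_mem _ ePositiveFamilies.toAddSubmonoid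
            (fun q s hqs => ih _ ?_ _ (hcomap _ ?_) q s hqs rfl) q s hqs
          · rw [← hn, ← Fintype.card_congr e, Fintype.card_option, Fintype.card_option]
            omega
          · exact e.injective.comp ((Option.some_injective _).comp (Option.some_injective _))
        · rwa [e1, e2]
        · intro w
          by_contra h
          rw [e1] at h
          have := hG v _ _ huv ?_ hu h
          · exact absurd (e.injective (e2.trans this)) (by simp)
          · exact fun h => absurd (e.injective (h.trans e1.symm)) (by simp)
        · intro w
          by_contra h
          rw [e2] at h
          have := hG u v _ huv.symm ?_ (fun h => hu h.symm) h
          · exact absurd (e.injective (e1.trans this)) (by simp)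
          · exact fun h => absurd (e.injective (h.trans e2.symm)) (by simp)

theorem listColoringSum_mem_of_compl_matching (G : SimpleGraph V)
    (hG : ∀ v u w, u ≠ v → w ≠ v → ¬ G.Adj v u → ¬ G.Adj v w → u = w) :
    (fun C => listColoringSum MvPolynomial.X G (fun _ => C)) ∈ ePositiveFamilies := by
  have := twoSetSum_listColoringSum_mem G hG 0 0 le_rfl
  convert this using 1
  funext C
  simp [twoSetSum]

end ComplementsOfMatchings

/-! ### Structure of connected claw-free and paw-free graphs. -/

namespace SimpleGraph

variable {V : Type*} {G : SimpleGraph V}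

/-- `G` has no induced claw. -/
def ClawFree (G : SimpleGraph V) : Prop :=
  ∀ w a b c, a ≠ b → a ≠ c → b ≠ c → G.Adj w a → G.Adj w b → G.Adj w c →
    G.Adj a b ∨ G.Adj a c ∨ G.Adj b c

/-- `G` has no induced paw. -/
def PawFree (G : SimpleGraph V) : Prop :=
  ∀ a b c d, G.Adj a b → G.Adj a c → G.Adj b c → G.Adj a d → d ≠ b → d ≠ c →
    G.Adj d b ∨ G.Adj d c

theorem clawFree_of_not_isIndContained (h : ¬ clawGraph.IsIndContained G) : G.ClawFree := by
  intro w a b c hab hac hbc ha hb hc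
  by_contra! hn
  obtain ⟨n1, n2, n3⟩ := hn
  refine h ⟨⟨⟨Sum.elim (fun _ => w) ![a, b, c], ?_⟩, ?_⟩⟩
  · rintro (i | i) (j | j) <;> fin_cases i <;> fin_cases j <;>
      simp [ha.ne, hb.ne, hc.ne, ha.ne', hb.ne', hc.ne', hab, hac, hbc, hab.symm, hac.symm, hbc.symm]
  · intro i j
    change G.Adj (Sum.elim (fun _ => w) ![a, b, c] i) (Sum.elim (fun _ => w) ![a, b, c] j) ↔ _
    rcases i with i | i <;> rcases j with j | j <;> fin_cases i <;> fin_cases j <;>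
      simp [clawGraph, ha, hb, hc, ha.symm, hb.symm, hc.symm, n1, n2, n3, G.adj_comm b a,
        G.adj_comm c a, G.adj_comm c b]

theorem pawFree_of_not_isIndContained (h : ¬ pawGraph.IsIndContained G) : G.PawFree := by
  intro a b c d hab hac hbc had hdb hdc
  by_contra! hn
  obtain ⟨n1, n2⟩ := hn
  refine h ⟨⟨⟨![d, a, b, c], ?_⟩, ?_⟩⟩
  · intro i j
    fin_cases i <;> fin_cases j <;>
      simp [hab.ne, hac.ne, hbc.ne, had.ne, hab.ne', hac.ne', hbc.ne', had.ne', hdb, hdc, hdb.symm,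
        hdc.symm]
  · intro i j
    change G.Adj (![d, a, b, c] i) (![d, a, b, c] j) ↔ _
    fin_cases i <;> fin_cases j <;>
      simp [pawGraph, hab, hac, hbc, had, hab.symm, hac.symm, hbc.symm, had.symm, n1, n2,
        G.adj_comm b d, G.adj_comm c d]

theorem ClawFree.comap {W : Type*} {f : W → V} (hf : Function.Injective f) (h : G.ClawFree) :
    (G.comap f).ClawFree :=
  fun _ _ _ _ h1 h2 h3 => h _ _ _ _ (hf.ne h1) (hf.ne h2) (hf.ne h3)

theorem PawFree.comap {W : Type*} {f : W → V} (hf : Function.Injective f) (h : G.PawFree) :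
    (G.comap f).PawFree :=
  fun _ _ _ _ h1 h2 h3 h4 h5 h6 => h _ _ _ _ h1 h2 h3 h4 (hf.ne h5) (hf.ne h6)

theorem Preconnected.mem_of_closed (hG : G.Preconnected) {S : Set V} {a : V} (ha : a ∈ S)
    (h : ∀ v w, v ∈ S → G.Adj v w → w ∈ S) (b : V) : b ∈ S := by
  obtain ⟨p⟩ := hG a b
  induction p with
  | nil => exact ha
  | cons hadj _ ih => exact ih (h _ _ ha hadj)

/-- An edge at a vertex of a triangle lies in a triangle itself, for otherwise it would be the
pendant edge of a paw. By connectedness this reaches every edge. -/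
theorem PawFree.exists_triangle (hp : G.PawFree) (hG : G.Preconnected) {a b c : V}
    (hab : G.Adj a b) (hac : G.Adj a c) (hbc : G.Adj b c) {x y : V} (hxy : G.Adj x y) :
    ∃ z, G.Adj x z ∧ G.Adj y z := by
  have key : ∀ a b c d, G.Adj a b → G.Adj a c → G.Adj b c → G.Adj a d →
      ∃ z, G.Adj a z ∧ G.Adj d z := by
    intro a b c d hab hac hbc had
    by_cases hdb : d = b
    · exact ⟨c, hac, hdb ▸ hbc⟩
    by_cases hdc : d = c
    · exact ⟨b, hab, hdc ▸ hbc.symm⟩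
    rcases hp a b c d hab hac hbc had hdb hdc with h | h
    · exact ⟨b, hab, h⟩
    · exact ⟨c, hac, h⟩
  have hx : x ∈ {v | ∃ b c, G.Adj v b ∧ G.Adj v c ∧ G.Adj b c} := by
    refine hG.mem_of_closed (S := {v | ∃ b c, G.Adj v b ∧ G.Adj v c ∧ G.Adj b c}) (a := a)
      ⟨b, c, hab, hac, hbc⟩ ?_ x
    rintro v w ⟨b, c, hb, hc, hbc⟩ hvw
    obtain ⟨z, hz, hz'⟩ := key v b c w hb hc hbc hvw
    exact ⟨v, z, hvw.symm, hz', hz⟩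
  obtain ⟨b, c, hb, hc, hbc⟩ := hx
  exact key x b c y hb hc hbc hxy

/-- In a connected paw-free graph with a triangle every edge is dominating. -/
theorem PawFree.adj_or_adj (hp : G.PawFree) (hG : G.Preconnected) {a b c : V}
    (hab : G.Adj a b) (hac : G.Adj a c) (hbc : G.Adj b c) {x y : V} (hxy : G.Adj x y) (z : V)
    (hzx : z ≠ x) (hzy : z ≠ y) : G.Adj z x ∨ G.Adj z y := by
  -- Vertices within distance one of the edge xy form a closed set: let z be reached through a
  -- neighbor w of x. If w is not adjacent to y, take a triangle xyt; then w is adjacent to t, and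
  -- paw-freeness is applied to wxt and, if z is adjacent to t, to txy.
  have key : ∀ x y w z, G.Adj x y → z ≠ x → z ≠ y → G.Adj x w → w ≠ y → G.Adj w z →
      G.Adj z x ∨ G.Adj z y := by
    intro x y w z hxy hzx hzy hxw hwy hwz
    by_cases hyw : G.Adj y w
    · exact hp w x y z hxw.symm hyw.symm hxy hwz hzx hzy
    obtain ⟨t, hxt, hyt⟩ := hp.exists_triangle hG hab hac hbc hxy
    by_cases hzt : z = t
    · subst hzt
      exact Or.inl hxt.symm
    have hwt : w ≠ t := fun h => hyw (h ▸ hyt)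
    have h1 : G.Adj w t := (hp x y t w hxy hxt hyt hxw hwy hwt).resolve_left fun h => hyw h.symm
    rcases hp w x t z hxw.symm h1 hxt hwz hzx hzt with h | h
    · exact Or.inl h
    · exact hp t x y z hxt.symm hyt.symm hxy h.symm hzx hzy
  have hz : z ∈ {v | v = x ∨ v = y ∨ G.Adj v x ∨ G.Adj v y} := by
    refine hG.mem_of_closed (a := x) (Or.inl rfl) ?_ z
    intro w z hw hwz
    simp only [Set.mem_ofPred_eq] at hw ⊢
    by_cases hzx : z = x
    · exact Or.inl hzx
    by_cases hzy : z = y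
    · exact Or.inr (Or.inl hzy)
    refine Or.inr (Or.inr ?_)
    by_cases hwx : w = x
    · exact Or.inl (hwx ▸ hwz.symm)
    by_cases hwy : w = y
    · exact Or.inr (hwy ▸ hwz.symm)
    rcases hw with h | h | h | h
    · exact absurd h hwx
    · exact absurd h hwy
    · exact key x y w z hxy hzx hzy h.symm hwy hwz
    · exact (key y x w z hxy.symm hzy hzx h.symm hwx hwz).symm
  rcases hz with h | h | h
  · exact absurd h hzx
  · exact absurd h hzy
  · exact h

/-- Let u ≠ w be non-neighbors of v. An edge uw would dominate v, so u and w are not adjacent. A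
neighbor t of v exists, and since the edge vt dominates u and w, both are adjacent to t. This is a
claw centered at t. -/
theorem ClawFree.eq_of_not_adj (hc : G.ClawFree) (hp : G.PawFree) (hG : G.Preconnected)
    {a b c : V} (hab : G.Adj a b) (hac : G.Adj a c) (hbc : G.Adj b c) (v u w : V) (hu : u ≠ v)
    (hw : w ≠ v) (hvu : ¬ G.Adj v u) (hvw : ¬ G.Adj v w) : u = w := by
  by_contra huw
  have huw' : ¬ G.Adj u w := fun h =>
    (hp.adj_or_adj hG hab hac hbc h v hu.symm hw.symm).elim hvu hvw
  obtain ⟨t, ht⟩ : ∃ t, G.Adj v t := by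
    by_contra! h
    refine hu (hG.mem_of_closed (S := {v}) rfl ?_ u)
    rintro _ w rfl h'
    exact absurd h' (h w)
  have htu : G.Adj u t := (hp.adj_or_adj hG hab hac hbc ht u hu
    (fun h => hvu (h ▸ ht))).resolve_left fun h => hvu h.symm
  have htw : G.Adj w t := (hp.adj_or_adj hG hab hac hbc ht w hw
    (fun h => hvw (h ▸ ht))).resolve_left fun h => hvw h.symm
  rcases hc t v u w hu.symm hw.symm huw ht.symm htu.symm htw.symm with h | h | h
  · exact hvu h
  · exact hvw h
  · exact huw' h

/-- A connected graph of maximal degree at most two is a path or a cycle. -/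
theorem Preconnected.exists_equiv_fin [Fintype V] [Nonempty V] (hG : G.Preconnected)
    (hdeg : ∀ w a b c, G.Adj w a → G.Adj w b → G.Adj w c → a = b ∨ a = c ∨ b = c) :
    ∃ (m : ℕ) (e : Fin (m + 1) ≃ V), (∀ i j, (pathGraph (m + 1)).Adj i j → G.Adj (e i) (e j)) ∧
      ∀ i j, G.Adj (e i) (e j) → (i = 0 ∧ j = Fin.last m ∨ j = 0 ∧ i = Fin.last m) ∨ (pathGraph (m + 1)).Adj i j := by
  classical
  -- On a longest path the ends have no neighbors outside it by maximality, and inner vertices have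
  -- none by the degree bound. So it covers the graph, and the only possible further edge joins its
  -- ends.
  obtain ⟨u, v, p, hp, hmax⟩ := Walk.exists_isPath_forall_isPath_length_le_length G
  have hinj := hp.getVert_injOn
  have hadj : ∀ i < p.length, G.Adj (p.getVert i) (p.getVert (i + 1)) := fun i hi =>
    p.adj_getVert_succ hi
  have hint : ∀ i, 0 < i → i < p.length → ∀ w, G.Adj (p.getVert i) w →
      w = p.getVert (i - 1) ∨ w = p.getVert (i + 1) := by
    intro i h0 hi w hw
    have h1 := hadj (i - 1) (by omega)
    rw [Nat.sub_add_cancel h0] at h1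
    rcases hdeg _ _ _ _ hw h1.symm (hadj i hi) with h | h | h
    · exact Or.inl h
    · exact Or.inr h
    · have := hinj (by simp; omega) (by simp; omega) h
      omega
  have hclosed : ∀ w w', w ∈ p.support → G.Adj w w' → w' ∈ p.support := by
    intro w w' hw hww'
    obtain ⟨i, rfl, hi⟩ := (Walk.mem_support_iff_exists_getVert).1 hw
    by_contra hw'
    rcases Nat.eq_zero_or_pos i with rfl | h0
    · rw [Walk.getVert_zero] at hww'
      have := hmax _ _ (Walk.cons hww'.symm p) ((Walk.cons_isPath_iff _ _).2 ⟨hp, hw'⟩)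
      simp at this
    rcases hi.eq_or_lt with rfl | hi
    · rw [Walk.getVert_length] at hww'
      have := hmax _ _ (Walk.cons hww'.symm p.reverse)
        ((Walk.cons_isPath_iff _ _).2 ⟨hp.reverse, by simpa using hw'⟩)
      simp at this
    · rcases hint i h0 hi w' hww' with rfl | rfl <;> exact hw' (p.getVert_mem_support _)
  have hbij : Function.Bijective fun i : Fin (p.length + 1) => p.getVert i := by
    refine ⟨fun i j hij => Fin.ext (hinj ?_ ?_ hij), fun w => ?_⟩
    · exact Nat.lt_succ_iff.1 i.2
    · exact Nat.lt_succ_iff.1 j.2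
    · have hw : w ∈ p.support :=
        hG.mem_of_closed (S := {w | w ∈ p.support}) p.start_mem_support hclosed w
      obtain ⟨i, rfl, hi⟩ := (Walk.mem_support_iff_exists_getVert).1 hw
      exact ⟨⟨i, Nat.lt_succ_iff.2 hi⟩, rfl⟩
  have hlt : ∀ i j : ℕ, i < j → j ≤ p.length → G.Adj (p.getVert i) (p.getVert j) →
      i = 0 ∧ j = p.length ∨ i + 1 = j := by
    intro i j hij hj h
    by_contra! hn
    have hi : 0 < i ∨ j < p.length := by
      by_contra! h'
      exact hn.1 (by omega) (by omega)
    rcases hi with hi | hi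
    · rcases hint i hi (by omega) _ h with h | h <;>
      · have := hinj (by simp; omega) (by simp; omega) h
        omega
    · rcases hint j (by omega) hi _ h.symm with h | h <;>
      · have := hinj (by simp; omega) (by simp; omega) h
        omega
  refine ⟨p.length, Equiv.ofBijective _ hbij, fun i j hij => ?_, fun i j hij => ?_⟩
  · change G.Adj (p.getVert i) (p.getVert j)
    rcases pathGraph_adj.1 hij with h | h <;> rw [← h]
    · exact hadj i (by omega)
    · exact (hadj j (by omega)).symm
  have hij : G.Adj (p.getVert i) (p.getVert j) := hij
  rw [pathGraph_adj]
  simp only [Fin.ext_iff, Fin.val_last, Fin.val_zero]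
  rcases lt_trichotomy (i : ℕ) j with h | h | h
  · rcases hlt i j h (by omega) hij with h | h <;> omega
  · rw [h] at hij
    exact absurd hij G.irrefl
  · rcases hlt j i h (by omega) hij.symm with h | h <;> omega

end SimpleGraph

/-! ### Assembling the cases. -/

section ClawFreePawFree

variable {V : Type*} [Fintype V]

theorem listColoringSum_mem_of_degree_le_two [Nonempty V] (G : SimpleGraph V)
    (hG : G.Preconnected)
    (hdeg : ∀ w a b c, G.Adj w a → G.Adj w b → G.Adj w c → a = b ∨ a = c ∨ b = c) :
    (fun C => listColoringSum MvPolynomial.X G (fun _ => C)) ∈ ePositiveFamilies := by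
  obtain ⟨m, e, he, he'⟩ := hG.exists_equiv_fin hdeg
  simp only [← listColoringSum_comap_equiv MvPolynomial.X G _ e]
  -- A single edge (m = 1) falls under the cycles here, as the cycle of length two.
  by_cases h : G.Adj (e 0) (e (Fin.last m))
  · cases m with
    | zero => exact absurd h G.irrefl
    | succ m =>
      have hadj : ∀ i j, (G.comap e).Adj i j ↔ (SimpleGraph.pathGraph (m + 2)).Adj i j ∨
          (i = 0 ∧ j = Fin.last (m + 1)) ∨ (j = 0 ∧ i = Fin.last (m + 1)) := by
        refine fun i j => ⟨fun hij => (he' i j hij).symm, ?_⟩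
        rintro (hij | ⟨rfl, rfl⟩ | ⟨rfl, rfl⟩)
        · exact he i j hij
        · exact h
        · exact h.symm
      simp only [listColoringSum_eq_cycleSum _ _ m _ hadj]
      exact cycleSum_mem_ePositiveFamilies _
  · have : G.comap e = SimpleGraph.pathGraph (m + 1) := by
      ext i j
      refine ⟨fun hij => (he' i j hij).resolve_left ?_, he i j⟩
      rintro (⟨rfl, rfl⟩ | ⟨rfl, rfl⟩)
      · exact h hij
      · exact h hij.symm
    simp only [this, listColoringSum_pathGraph_eq_pathSum]
    exact pathSum_mem_ePositiveFamilies _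

theorem listColoringSum_mem_of_clawFree_of_pawFree (G : SimpleGraph V) (hc : G.ClawFree)
    (hp : G.PawFree) :
    (fun C => listColoringSum MvPolynomial.X G (fun _ => C)) ∈ ePositiveFamilies := by
  classical
  induction hn : Fintype.card V using Nat.strong_induction_on generalizing V with
  | _ n ih =>
    rcases isEmpty_or_nonempty V with hV | hV
    · simp only [listColoringSum_isEmpty]
      exact one_mem _
    by_cases hG : G.Preconnected
    · by_cases ht : ∃ a b c, G.Adj a b ∧ G.Adj a c ∧ G.Adj b c
      · obtain ⟨a, b, c, hab, hac, hbc⟩ := ht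
        exact listColoringSum_mem_of_compl_matching G (hc.eq_of_not_adj hp hG hab hac hbc)
      · push Not at ht
        refine listColoringSum_mem_of_degree_le_two G hG fun w a b c ha hb hc' => ?_
        by_contra! h
        rcases hc w a b c h.1 h.2.1 h.2.2 ha hb hc' with h | h | h
        · exact ht w a b ha hb h
        · exact ht w a c ha hc' h
        · exact ht w b c hb hc' h
    · simp only [SimpleGraph.Preconnected, not_forall] at hG
      obtain ⟨u, v, huv⟩ := hG
      -- The component of `u` is split off. It misses `v` and the rest misses `u`, so both parts are
      -- smaller.
      have : (fun C => listColoringSum MvPolynomial.X G (fun _ => C) :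
          Finset ℕ → MvPolynomial ℕ ℚ) =
          (fun C => listColoringSum MvPolynomial.X
            (G.comap (Subtype.val : {w // G.Reachable u w} → V)) (fun _ => C)) *
          fun C => listColoringSum MvPolynomial.X
            (G.comap (Subtype.val : {w // ¬ G.Reachable u w} → V)) (fun _ => C) := by
        funext C
        exact listColoringSum_mul_of_forall_not_adj _ G _ _
          fun a b ha hb hab => hb (ha.trans hab.reachable)
      rw [this]
      refine mul_mem (ih _ ?_ _ (hc.comap Subtype.val_injective) (hp.comap Subtype.val_injective) rfl)
        (ih _ ?_ _ (hc.comap Subtype.val_injective) (hp.comap Subtype.val_injective) rfl)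
      · rw [← hn]
        exact Fintype.card_subtype_lt huv
      · rw [← hn]
        exact Fintype.card_subtype_lt (x := u) (not_not.2 (SimpleGraph.Reachable.refl u))

end ClawFreePawFree

end

theorem mainTheorem1 {V : Type*} [Fintype V] (G : SimpleGraph V)
    (hclaw : ¬ clawGraph.IsIndContained G) (hpaw : ¬ pawGraph.IsIndContained G) :
    IsEPositive (chromaticSymmetricFunction G) :=
  isEPositive_of_listColoringSum_mem G (listColoringSum_mem_of_clawFree_of_pawFree G
    (SimpleGraph.clawFree_of_not_isIndContained hclaw)
    (SimpleGraph.pawFree_of_not_isIndContained hpaw))
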